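/- For a partition $\lambda$ (identified with its Ferrers diagram), the hook length of a box $v$ of $\lambda$ is the number of boxes of $\lambda$ consisting of $v$ itself, the boxes in the same row to the right of $v$, and the boxes in the same column on the side of $v$ away from the first row. Let $|\lambda|$ be the number of boxes of $\lambda$, and for a positive integer $t$ let $\mathcal{H}_t(\lambda)$ be the multiset of the hook lengths of the boxes of $\lambda$ that are integral multiples of $t$ (counted once for each box); $\#\mathcal{H}_t(\lambda)$ is its cardinality with multiplicity. A partition is self-conjugate if its Ferrers diagram is symmetric about the principal diagonal; let $SC$ be the set of self-conjugate partitions. **Theorem.** For any positive integer $n$ and any even positive integer $t$, $$\sum_{\substack{\lambda \in SC,\ |\lambda| = 2tn\\ \#\mathcal{H}_t(\lambda) = 2n}}\ \prod_{h \in \mathcal{H}_t(\lambda)} \frac{1}{h} = \frac{1}{n!\,2^n\,t^n}.$$ -/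

import Mathlib

namespace YoungDiagram

/-- The hook of the box `c = (i, j)` (row `i`, column `j`, numbered from `0`): the boxes of `μ` in
row `i` at or to the right of `c`, and those in column `j` at or beyond `c`. The box `c` itself
belongs to its hook. -/
def hook (μ : YoungDiagram) (c : ℕ × ℕ) : Finset (ℕ × ℕ) :=
  μ.cells.filter fun u => (u.1 = c.1 ∧ c.2 ≤ u.2) ∨ (u.2 = c.2 ∧ c.1 ≤ u.1)

/-- The hook length of a box is the number of boxes of its hook. -/
def hookLength (μ : YoungDiagram) (c : ℕ × ℕ) : ℕ := (μ.hook c).card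

/-- The multiset `H(μ)` of all hook lengths of `μ`, one for each box. -/
def hookLengths (μ : YoungDiagram) : Multiset ℕ := μ.cells.val.map μ.hookLength

/-- The multiset `H_t(μ)` of the hook lengths of `μ` that are integral multiples of `t`. -/
def hookLengthsDvd (t : ℕ) (μ : YoungDiagram) : Multiset ℕ :=
  μ.hookLengths.filter fun h => t ∣ h

/-- A partition is self-conjugate if its diagram is symmetric about the principal diagonal. -/
def IsSelfConjugate (μ : YoungDiagram) : Prop := μ.transpose = μ

theorem finite_card_eq (m : ℕ) : {μ : YoungDiagram | μ.card = m}.Finite := by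
  refine Set.Finite.of_finite_image (f := YoungDiagram.cells) ?_
    (fun μ _ ν _ h => YoungDiagram.ext h)
  refine ((Finset.range m ×ˢ Finset.range m).powerset.finite_toSet).subset ?_
  rintro _ ⟨μ, hμ, rfl⟩
  have hμ' : μ.cells.card = m := hμ
  simp only [Finset.coe_powerset, Set.mem_preimage, Set.mem_powerset_iff, Finset.coe_subset]
  rintro ⟨i, j⟩ hij
  rw [mem_cells] at hij
  rw [Finset.mem_product, Finset.mem_range, Finset.mem_range]
  constructor
  · have h : μ.colLen j ≤ m := by
      rw [colLen_eq_card, ← hμ']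
      exact Finset.card_le_card (Finset.filter_subset _ _)
    exact lt_of_lt_of_le (mem_iff_lt_colLen.1 hij) h
  · have h : μ.rowLen i ≤ m := by
      rw [rowLen_eq_card, ← hμ']
      exact Finset.card_le_card (Finset.filter_subset _ _)
    exact lt_of_lt_of_le (mem_iff_lt_rowLen.1 hij) h

theorem finite_selfConjugate (m t k : ℕ) :
    {μ : YoungDiagram | μ.IsSelfConjugate ∧ μ.card = m ∧
      Multiset.card (μ.hookLengthsDvd t) = k}.Finite :=
  (finite_card_eq m).subset fun _ h => h.2.1

/-- The finite set of the self-conjugate partitions of weight `m` with exactly `k` boxes whose hook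
length is a multiple of `t`. -/
noncomputable def selfConjugateWith (m t k : ℕ) : Finset YoungDiagram :=
  (finite_selfConjugate m t k).toFinset

end YoungDiagram

open Polynomial in
theorem Polynomial.exists_X_mul_prod_eq {F : Type*} [Field F] (T : Finset F) :
    ∃ r : F[X], r.degree < T.card ∧ r.coeff (T.card - 1) = T.card.choose 2 - ∑ x ∈ T, x ∧
      X * ∏ s ∈ T, (X - C (1 + s)) = (X - C (T.card : F)) * ∏ s ∈ T, (X - C s) + r := by
  classical
  induction T using Finset.induction_on with
  | empty => exact ⟨0, by simp, by simp, by simp⟩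
  | insert a T ha ih =>
    obtain ⟨r, hdeg, hcoeff, heq⟩ := ih
    have hmonic : (∏ s ∈ T, (X - C s)).Monic := monic_prod_X_sub_C _ _
    have hnat : (∏ s ∈ T, (X - C s)).natDegree = T.card := natDegree_finsetProd_X_sub_C_eq_card _ _
    have hQ : (∏ s ∈ T, (X - C s)).coeff T.card = 1 := by
      rw [← hnat]; exact hmonic.coeff_natDegree
    have hQdeg : (∏ s ∈ T, (X - C s)).degree ≤ ((T.card : ℕ) : WithBot ℕ) := by
      rw [← hnat]; exact degree_le_natDegree
    have hr : r.coeff T.card = 0 := coeff_eq_zero_of_degree_lt hdeg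
    refine ⟨C ((T.card : F) - a) * ∏ s ∈ T, (X - C s) + r * (X - C (1 + a)), ?_, ?_, ?_⟩
    · rw [Finset.card_insert_of_notMem ha, degree_lt_iff_coeff_zero]
      intro m hm
      obtain ⟨m, rfl⟩ : ∃ k, m = k + 1 := ⟨m - 1, by omega⟩
      have h1 : T.card ≤ m := by omega
      have h2 : (T.card : WithBot ℕ) ≤ m := by exact_mod_cast h1
      have h3 : (m : WithBot ℕ) < (m + 1 : ℕ) := by exact_mod_cast Nat.lt_succ_self m
      rw [coeff_add, coeff_C_mul, coeff_eq_zero_of_degree_lt (hQdeg.trans_lt (h2.trans_lt h3)),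
        coeff_mul_X_sub_C, coeff_eq_zero_of_degree_lt (hdeg.trans_le h2),
        coeff_eq_zero_of_degree_lt (hdeg.trans_le (h2.trans h3.le))]
      simp
    · rw [Finset.card_insert_of_notMem ha, Finset.sum_insert ha, Nat.add_sub_cancel, coeff_add,
        coeff_C_mul, hQ, mul_sub, coeff_sub, coeff_mul_C, hr, Nat.choose_succ_succ' T.card 1]
      rcases Nat.eq_zero_or_pos T.card with h0 | h0
      · have : T = ∅ := Finset.card_eq_zero.1 h0
        subst this
        have : r = 0 := by simpa using hdeg
        simp [this]
      · obtain ⟨m, hm⟩ : ∃ k, T.card = k + 1 := ⟨T.card - 1, by omega⟩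
        rw [hm] at hcoeff ⊢
        rw [coeff_mul_X]
        simp only [Nat.add_sub_cancel] at hcoeff
        rw [hcoeff]
        push_cast
        simp
        ring
    · rw [Finset.prod_insert ha, Finset.prod_insert ha, Finset.card_insert_of_notMem ha]
      have : X * ((X - C (1 + a)) * ∏ s ∈ T, (X - C (1 + s)))
        = (X - C (1 + a)) * (X * ∏ s ∈ T, (X - C (1 + s))) := by ring
      rw [this, heq]
      simp only [map_sub, map_add, map_one, Nat.cast_add, Nat.cast_one]
      ring

open Polynomial in
theorem Finset.sum_mul_prod_sub_one_div {F : Type*} [Field F] [DecidableEq F] (T : Finset F) :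
    ∑ x ∈ T, x * ∏ s ∈ T.erase x, (x - 1 - s) / (x - s) = ∑ x ∈ T, x - T.card.choose 2 := by
  obtain ⟨r, hdeg, hcoeff, heq⟩ := Polynomial.exists_X_mul_prod_eq T
  have h := Lagrange.coeff_eq_sum (s := T) (v := id) (Set.injOn_id _) hdeg
  rw [hcoeff] at h
  rw [← neg_sub, h, ← Finset.sum_neg_distrib]
  refine Finset.sum_congr rfl fun x hx => ?_
  have hev : r.eval x = -(x * ∏ s ∈ T.erase x, (x - 1 - s)) := by
    have := congrArg (Polynomial.eval x) heq
    simp only [eval_mul, eval_X, eval_add, eval_prod, eval_sub, eval_C] at this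
    rw [← Finset.mul_prod_erase T _ hx, ← Finset.mul_prod_erase T (fun s => x - s) hx] at this
    simp only [sub_self, zero_mul, mul_zero, zero_add] at this
    rw [← this]
    simp only [sub_add_eq_sub_sub]
    ring
  rw [id, hev, Finset.prod_div_distrib]
  simp only [id]
  ring

open Polynomial in
theorem Finset.sum_prod_add_one_div {F : Type*} [Field F] [DecidableEq F] (T : Finset F)
    (h0 : (0 : F) ∈ T) (h1 : (-1 : F) ∉ T) :
    ∑ x ∈ T, (∏ s ∈ T.erase x, (x + 1 - s) / (x - s)) / (x + 1) = 1 := by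
  have hmonic : (∏ s ∈ T, (X - C (s - 1))).Monic := monic_prod_X_sub_C _ _
  have hnat : (∏ s ∈ T, (X - C (s - 1))).natDegree = T.card :=
    natDegree_finsetProd_X_sub_C_eq_card _ _
  have h := Lagrange.coeff_eq_sum (s := insert (-1) T) (v := id) (Set.injOn_id _)
    (P := ∏ s ∈ T, (X - C (s - 1))) (by
      rw [Finset.card_insert_of_notMem h1, degree_eq_natDegree hmonic.ne_zero, hnat]
      exact_mod_cast Nat.lt_succ_self _)
  rw [Finset.card_insert_of_notMem h1, Nat.add_sub_cancel, ← hnat, hmonic.coeff_natDegree,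
    Finset.sum_insert h1] at h
  refine Eq.trans ?_ h.symm
  have hz : eval (id (-1 : F)) (∏ s ∈ T, (X - C (s - 1))) = 0 := by
    rw [eval_prod]
    exact Finset.prod_eq_zero h0 (by simp)
  rw [hz, zero_div, zero_add]
  refine Finset.sum_congr rfl fun x hx => ?_
  have hne : (-1 : F) ≠ x := fun h => h1 (h ▸ hx)
  rw [Finset.erase_insert_of_ne hne, Finset.prod_insert (fun h => h1 (Finset.mem_of_mem_erase h)),
    eval_prod, ← Finset.mul_prod_erase T _ hx, Finset.prod_div_distrib]
  simp only [id, eval_sub, eval_X, eval_C, sub_neg_eq_add, sub_sub_cancel, one_mul]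
  rw [div_div, mul_comm (x + 1)]
  congr 1
  exact Finset.prod_congr rfl fun s _ => by ring

namespace BeadSet

open Finset

/-- The pairs `⟨x, y⟩` of a bead `x ∈ X` and a gap `y ∉ X` below it. For the set of beads of a
partition they correspond to the boxes, and `x - y` is the hook length. -/
def inversions (X : Finset ℕ) : Finset (Σ _ : ℕ, ℕ) := X.sigma fun x => range x \ X

theorem mem_inversions {X : Finset ℕ} {p : Σ _ : ℕ, ℕ} :
    p ∈ inversions X ↔ p.1 ∈ X ∧ p.2 < p.1 ∧ p.2 ∉ X := by
  simp [inversions]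

/-- The number of inversions, the size of the corresponding partition. -/
def weight (X : Finset ℕ) : ℕ := (inversions X).card

/-- The product of the inverse hook lengths. -/
def hookProd (X : Finset ℕ) : ℚ := ∏ p ∈ inversions X, ((p.1 : ℚ) - p.2)⁻¹

theorem hookProd_eq (X : Finset ℕ) :
    hookProd X = (∏ x ∈ X, ∏ y ∈ X, if y < x then (x : ℚ) - y else 1) /
      ∏ x ∈ X, (x.factorial : ℚ) := by
  rw [hookProd, inversions, prod_sigma, ← prod_div_distrib]
  refine prod_congr rfl fun x _ => ?_
  have hfac : (x.factorial : ℚ) = ∏ y ∈ range x, ((x : ℚ) - y) := by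
    rw [← prod_range_reflect, ← prod_range_add_one_eq_factorial, Nat.cast_prod]
    refine prod_congr rfl fun y hy => ?_
    have := mem_range.1 hy
    rw [Nat.sub_sub, Nat.cast_sub (by omega)]
    push_cast
    ring
  have hne : ∀ y ∈ range x, (x : ℚ) - y ≠ 0 := fun y hy => by
    have : (y : ℚ) < x := by exact_mod_cast mem_range.1 hy
    exact (sub_pos.2 this).ne'
  rw [hfac, ← prod_filter, prod_inv_distrib, eq_div_iff (prod_ne_zero_iff.2 hne),
    ← prod_sdiff (sdiff_subset : range x \ X ⊆ range x), ← mul_assoc, mul_comm, ← mul_assoc,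
    mul_inv_cancel₀ (prod_ne_zero_iff.2 fun y hy => hne y (sdiff_subset hy)), one_mul]
  refine prod_congr ?_ fun _ _ => rfl
  ext y
  simp only [mem_sdiff, mem_range, mem_filter]
  tauto

theorem weight_add_choose (X : Finset ℕ) : weight X + X.card.choose 2 = ∑ x ∈ X, x := by
  have h1 : ∀ X : Finset ℕ, ∑ x ∈ X, (X.filter (· < x)).card = X.card.choose 2 := fun X => by
    induction X using Finset.induction_on_max with
    | empty => rfl
    | insert a X ha ih =>
      have hn : a ∉ X := fun h => lt_irrefl _ (ha a h)
      rw [sum_insert hn, card_insert_of_notMem hn, Nat.choose_succ_succ' X.card 1, Nat.choose_one_right,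
        ← ih]
      congr 1
      · rw [filter_insert, if_neg (lt_irrefl a), filter_true_of_mem ha]
      · refine sum_congr rfl fun x hx => ?_
        rw [filter_insert, if_neg (ha x hx).not_gt]
  rw [← h1, weight, inversions, card_sigma, ← sum_add_distrib]
  refine sum_congr rfl fun x _ => ?_
  rw [show X.filter (· < x) = range x ∩ X by ext; simp [and_comm], card_sdiff_add_card_inter,
    card_range]

theorem hookProd_insert {S : Finset ℕ} {a : ℕ} (ha : a ∉ S) :
    hookProd (insert a S) = hookProd S * (∏ s ∈ S, |(a : ℚ) - s|) / a.factorial := by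
  rw [hookProd_eq, hookProd_eq, prod_insert ha, prod_insert ha, prod_insert ha, if_neg (lt_irrefl a),
    one_mul]
  simp_rw [prod_insert ha]
  rw [prod_mul_distrib]
  have : (∏ s ∈ S, |(a : ℚ) - s|) = (∏ s ∈ S, if s < a then (a : ℚ) - s else 1) *
      ∏ s ∈ S, if a < s then (s : ℚ) - a else 1 := by
    rw [← prod_mul_distrib]
    refine prod_congr rfl fun s hs => ?_
    have hne : s ≠ a := fun h => ha (h ▸ hs)
    rcases lt_or_gt_of_ne hne with h | h
    · have h' : (s : ℚ) < a := by exact_mod_cast h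
      rw [if_pos h, if_neg h.not_gt, mul_one, abs_of_pos (sub_pos.2 h')]
    · have h' : (a : ℚ) < s := by exact_mod_cast h
      rw [if_pos h, if_neg h.not_gt, one_mul, abs_sub_comm, abs_of_pos (sub_pos.2 h')]
  rw [this, mul_comm (a.factorial : ℚ)]
  field_simp

theorem hookProd_insert_succ {S : Finset ℕ} {a : ℕ} (ha : a ∉ S) (ha' : a + 1 ∉ S) :
    hookProd (insert (a + 1) S) =
      hookProd (insert a S) * ((∏ s ∈ S, ((a : ℚ) + 1 - s) / (a - s)) / (a + 1)) := by
  have hne : ∏ s ∈ S, |(a : ℚ) - s| ≠ 0 := prod_ne_zero_iff.2 fun s hs => by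
    rw [abs_ne_zero, sub_ne_zero]
    exact fun h => ha (by rw [Nat.cast_injective h]; exact hs)
  have : ∏ s ∈ S, ((a : ℚ) + 1 - s) / (a - s) =
      (∏ s ∈ S, |((a + 1 : ℕ) : ℚ) - s|) / ∏ s ∈ S, |(a : ℚ) - s| := by
    rw [← prod_div_distrib]
    refine prod_congr rfl fun s hs => ?_
    rw [← abs_div, Nat.cast_add_one, abs_of_nonneg]
    have h1 : s ≠ a := fun h => ha (h ▸ hs)
    have h2 : s ≠ a + 1 := fun h => ha' (h ▸ hs)
    rcases lt_or_gt_of_ne h1 with h | h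
    · have h' : (s : ℚ) < a := by exact_mod_cast h
      exact div_nonneg (by linarith) (by linarith)
    · have h' : (a : ℚ) + 1 ≤ s := by exact_mod_cast h
      exact div_nonneg_of_nonpos (by linarith) (by linarith)
  rw [hookProd_insert ha, hookProd_insert ha', this, Nat.factorial_succ]
  have h3 : (a.factorial : ℚ) ≠ 0 := by exact_mod_cast a.factorial_ne_zero
  have h4 : (a : ℚ) + 1 ≠ 0 := by positivity
  push_cast
  field_simp

/-- Moving one bead up by one step, summed over the possible beads. -/
theorem sum_hookProd_up {X : Finset ℕ} (h0 : 0 ∈ X) :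
    ∑ x ∈ X with x + 1 ∉ X, hookProd (insert (x + 1) (X.erase x)) = hookProd X := by
  have key := Finset.sum_prod_add_one_div (X.map (Nat.castEmbedding : ℕ ↪ ℚ))
    (by simpa using h0) (by
      simp only [mem_map, Nat.castEmbedding_apply, not_exists, not_and]
      intro x _ h
      have : (0 : ℚ) ≤ x := by positivity
      linarith)
  rw [sum_map] at key
  simp_rw [← map_erase, prod_map, Nat.castEmbedding_apply] at key
  rw [← mul_one (hookProd X), ← key, mul_sum, sum_filter]
  refine sum_congr rfl fun x hx => ?_
  by_cases h : x + 1 ∈ X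
  swap
  · rw [if_pos h]
    have := hookProd_insert_succ (S := X.erase x) (a := x) (by simp)
      (fun hh => h (mem_of_mem_erase hh))
    rw [this, insert_erase hx]
  · rw [if_neg (not_not.2 h), prod_eq_zero (i := x + 1) (by simpa using h) (by simp)]
    simp

/-- Moving one bead down by one step, summed over the possible beads. -/
theorem sum_hookProd_down (X : Finset ℕ) :
    ∑ x ∈ X with x ≠ 0 ∧ x - 1 ∉ X, hookProd (insert (x - 1) (X.erase x)) =
      weight X * hookProd X := by
  have key := Finset.sum_mul_prod_sub_one_div (X.map (Nat.castEmbedding : ℕ ↪ ℚ))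
  rw [sum_map, sum_map, card_map] at key
  simp_rw [← map_erase, prod_map, Nat.castEmbedding_apply] at key
  have hw : (weight X : ℚ) = ∑ x ∈ X, (x : ℚ) - X.card.choose 2 := by
    rw [eq_sub_iff_add_eq]
    rw [← Nat.cast_add, weight_add_choose, Nat.cast_sum]
  rw [hw, ← key, sum_mul, sum_filter]
  refine sum_congr rfl fun x hx => ?_
  rcases Nat.eq_zero_or_pos x with rfl | hpos
  · simp
  obtain ⟨a, rfl⟩ : ∃ a, x = a + 1 := ⟨x - 1, by omega⟩
  simp only [Nat.add_sub_cancel, Nat.cast_add_one, add_sub_cancel_right, ne_eq, Nat.add_eq_zero_iff,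
    one_ne_zero, and_false, not_false_eq_true, true_and]
  by_cases h : a ∈ X
  swap
  · rw [if_pos h]
    have hS : a ∉ X.erase (a + 1) := fun hh => h (mem_of_mem_erase hh)
    have := hookProd_insert_succ hS (notMem_erase _ _)
    rw [insert_erase hx] at this
    rw [this, prod_div_distrib, prod_div_distrib]
    have h1 : ∏ s ∈ X.erase (a + 1), ((a : ℚ) - s) ≠ 0 := prod_ne_zero_iff.2 fun s hs => by
      rw [sub_ne_zero]
      exact fun h => hS ((Nat.cast_injective h : a = s) ▸ hs)
    have h2 : ∏ s ∈ X.erase (a + 1), ((a : ℚ) + 1 - s) ≠ 0 := prod_ne_zero_iff.2 fun s hs => by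
      rw [sub_ne_zero, ← Nat.cast_add_one]
      exact fun h => ne_of_mem_erase hs (Nat.cast_injective h).symm
    have h4 : (a : ℚ) + 1 ≠ 0 := by positivity
    field_simp
  · rw [if_neg (not_not.2 h), prod_eq_zero (i := a) (by simpa using h) (by simp)]
    simp

end BeadSet

namespace BeadSet

open Finset

theorem lt_card_add_weight {X : Finset ℕ} {x : ℕ} (hx : x ∈ X) : x < X.card + weight X := by
  have h1 : (range x \ X).card ≤ weight X := by
    rw [weight, inversions, card_sigma]
    exact single_le_sum (f := fun x => (range x \ X).card) (fun _ _ => Nat.zero_le _) hx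
  have h2 : (range x ∩ X).card < X.card :=
    card_lt_card ⟨inter_subset_right, fun h => by simpa using h hx⟩
  have h3 := card_sdiff_add_card_inter (range x) X
  rw [card_range] at h3
  omega

theorem zero_mem_of_weight_lt_card {X : Finset ℕ} (h : weight X < X.card) : 0 ∈ X := by
  by_contra h0
  refine h.not_ge ?_
  rw [weight, inversions, card_sigma, card_eq_sum_ones]
  refine sum_le_sum fun x hx => card_pos.2 ⟨0, ?_⟩
  have : x ≠ 0 := fun h => h0 (h ▸ hx)
  simp only [mem_sdiff, mem_range]
  exact ⟨Nat.pos_of_ne_zero this, h0⟩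

theorem card_insert_erase {X : Finset ℕ} {x y : ℕ} (hx : x ∈ X) (hy : y ∉ X) :
    (insert y (X.erase x)).card = X.card := by
  rw [card_insert_of_notMem (fun h => hy (mem_of_mem_erase h)), card_erase_add_one hx]

theorem weight_insert_erase {X : Finset ℕ} {x y : ℕ} (hx : x ∈ X) (hy : y ∉ X) :
    weight (insert y (X.erase x)) + x = weight X + y := by
  have h1 := weight_add_choose (insert y (X.erase x))
  have h2 := weight_add_choose X
  rw [card_insert_erase hx hy, sum_insert (fun h => hy (mem_of_mem_erase h))] at h1
  have h3 := add_sum_erase X id hx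
  simp only [id] at h3
  omega

/-- The bead sets of the partitions of `m` with at most `M` rows and columns. -/
def beadSets (M m : ℕ) : Finset (Finset ℕ) :=
  ((range (2 * M)).powersetCard M).filter fun X => weight X = m

theorem mem_beadSets {M m : ℕ} (hm : m ≤ M) {X : Finset ℕ} :
    X ∈ beadSets M m ↔ X.card = M ∧ weight X = m := by
  rw [beadSets, mem_filter, mem_powersetCard]
  refine ⟨fun h => ⟨h.1.2, h.2⟩, fun h => ⟨⟨fun x hx => ?_, h.1⟩, h.2⟩⟩
  have := lt_card_add_weight hx
  rw [mem_range]
  omega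

theorem weight_eq_zero_iff {X : Finset ℕ} : weight X = 0 ↔ X = range X.card := by
  constructor
  · intro h
    refine eq_of_subset_of_card_le (fun x hx => ?_) (by simp)
    have := lt_card_add_weight hx
    rw [mem_range]
    omega
  · intro h
    rw [weight, card_eq_zero, h]
    refine eq_empty_of_forall_notMem fun p hp => ?_
    obtain ⟨h1, h2, h3⟩ := mem_inversions.1 hp
    rw [mem_range] at h1 h3
    omega

theorem sum_sq_hookProd_succ {M m : ℕ} (hm : m < M) :
    ((m : ℚ) + 1) * ∑ X ∈ beadSets M (m + 1), hookProd X ^ 2 =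
      ∑ X ∈ beadSets M m, hookProd X ^ 2 := by
  have hdown : ∀ Y ∈ beadSets M (m + 1), ((m : ℚ) + 1) * hookProd Y ^ 2 =
      ∑ y ∈ Y with y ≠ 0 ∧ y - 1 ∉ Y, hookProd (insert (y - 1) (Y.erase y)) * hookProd Y := by
    intro Y hY
    rw [← sum_mul, sum_hookProd_down, ((mem_beadSets hm).1 hY).2]
    push_cast
    ring
  have hup : ∀ X ∈ beadSets M m, hookProd X ^ 2 =
      ∑ x ∈ X with x + 1 ∉ X, hookProd X * hookProd (insert (x + 1) (X.erase x)) := by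
    intro X hX
    obtain ⟨h1, h2⟩ := (mem_beadSets hm.le).1 hX
    rw [← mul_sum, sum_hookProd_up (zero_mem_of_weight_lt_card (by omega))]
    ring
  rw [mul_sum, sum_congr rfl hdown, sum_congr rfl hup, sum_sigma', sum_sigma']
  have hinv : ∀ {X : Finset ℕ} {x y : ℕ}, x ∈ X → y ∉ X →
      insert x ((insert y (X.erase x)).erase y) = X := fun {X x y} hx hy => by
    rw [erase_insert (fun h => hy (mem_of_mem_erase h)), insert_erase hx]
  refine sum_bij' (fun p _ => ⟨insert (p.2 - 1) (p.1.erase p.2), p.2 - 1⟩)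
    (fun p _ => ⟨insert (p.2 + 1) (p.1.erase p.2), p.2 + 1⟩) ?_ ?_ ?_ ?_ ?_
  · rintro ⟨Y, y⟩ h
    simp only [mem_sigma, mem_filter, mem_beadSets hm, mem_beadSets hm.le] at h ⊢
    obtain ⟨⟨h1, h2⟩, h3, h4, h5⟩ := h
    have := weight_insert_erase h3 h5
    refine ⟨⟨by rw [card_insert_erase h3 h5, h1], by omega⟩, mem_insert_self _ _, ?_⟩
    rw [Nat.sub_add_cancel (Nat.pos_of_ne_zero h4), mem_insert, not_or]
    exact ⟨by omega, notMem_erase _ _⟩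
  · rintro ⟨X, x⟩ h
    simp only [mem_sigma, mem_filter, mem_beadSets hm, mem_beadSets hm.le] at h ⊢
    obtain ⟨⟨h1, h2⟩, h3, h5⟩ := h
    have := weight_insert_erase h3 h5
    refine ⟨⟨by rw [card_insert_erase h3 h5, h1], by omega⟩, mem_insert_self _ _, by omega, ?_⟩
    rw [Nat.add_sub_cancel, mem_insert, not_or]
    exact ⟨by omega, notMem_erase _ _⟩
  · rintro ⟨Y, y⟩ h
    simp only [mem_sigma, mem_filter] at h
    obtain ⟨_, h3, h4, h5⟩ := h
    simp only [Nat.sub_add_cancel (Nat.pos_of_ne_zero h4), hinv h3 h5]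
  · rintro ⟨X, x⟩ h
    simp only [mem_sigma, mem_filter] at h
    obtain ⟨_, h3, h5⟩ := h
    simp only [Nat.add_sub_cancel, hinv h3 h5]
  · rintro ⟨Y, y⟩ h
    simp only [mem_sigma, mem_filter] at h
    obtain ⟨_, h3, h4, h5⟩ := h
    simp only [Nat.sub_add_cancel (Nat.pos_of_ne_zero h4), hinv h3 h5]

/-- The sum of the squared inverse hook products over the partitions of `m` is `1 / m!`. -/
theorem sum_sq_hookProd {M m : ℕ} (hm : m ≤ M) :
    ∑ X ∈ beadSets M m, hookProd X ^ 2 = 1 / (m.factorial : ℚ) := by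
  induction m with
  | zero =>
    have h : beadSets M 0 = {range M} := by
      ext X
      rw [mem_beadSets hm, weight_eq_zero_iff, mem_singleton]
      constructor
      · rintro ⟨rfl, h⟩
        exact h
      · rintro rfl
        simp
    have h0 : inversions (range M) = ∅ :=
      card_eq_zero.1 (weight_eq_zero_iff.2 (by simp) : weight (range M) = 0)
    rw [h, sum_singleton, hookProd, h0]
    simp
  | succ m ih =>
    have h := sum_sq_hookProd_succ (M := M) (m := m) hm
    rw [ih (by omega)] at h
    have h1 : (m : ℚ) + 1 ≠ 0 := by positivity
    rw [Nat.factorial_succ, Nat.cast_mul, Nat.cast_add_one, mul_comm ((m : ℚ) + 1), ← div_div,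
      eq_div_iff h1, mul_comm, h]

theorem sum_piFinset_hookProd {M n : ℕ} (s : ℕ) (hn : n ≤ M) :
    ∑ F ∈ (Fintype.piFinset fun _ : Fin s => (range (2 * M)).powersetCard M) with
        ∑ i, weight (F i) = n, ∏ i, hookProd (F i) ^ 2 = (s : ℚ) ^ n / n.factorial := by
  have hmaps : ∀ F ∈ (Fintype.piFinset fun _ : Fin s => (range (2 * M)).powersetCard M).filter
      (fun F => ∑ i, weight (F i) = n), (fun i => weight (F i)) ∈ piAntidiag univ n := by
    intro F hF
    rw [mem_piAntidiag]
    exact ⟨(mem_filter.1 hF).2, fun i _ => mem_univ i⟩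
  rw [← sum_fiberwise_of_maps_to hmaps]
  have hfib : ∀ k ∈ piAntidiag (univ : Finset (Fin s)) n,
      ∑ F ∈ (Fintype.piFinset fun _ : Fin s => (range (2 * M)).powersetCard M).filter
        (fun F => ∑ i, weight (F i) = n) with (fun i => weight (F i)) = k,
        ∏ i, hookProd (F i) ^ 2 = (Nat.multinomial univ k : ℚ) / n.factorial := by
    intro k hk
    have hsum : ∑ i, k i = n := (mem_piAntidiag.1 hk).1
    have hset : ((Fintype.piFinset fun _ : Fin s => (range (2 * M)).powersetCard M).filter
        (fun F => ∑ i, weight (F i) = n)).filter (fun F => (fun i => weight (F i)) = k) =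
        Fintype.piFinset fun i => beadSets M (k i) := by
      ext F
      simp only [mem_filter, Fintype.mem_piFinset, beadSets, funext_iff]
      refine ⟨fun h i => ⟨h.1.1 i, h.2 i⟩, fun h => ⟨⟨fun i => (h i).1, ?_⟩, fun i => (h i).2⟩⟩
      rw [← hsum]
      exact sum_congr rfl fun i _ => (h i).2
    rw [hset, ← prod_univ_sum (fun i => beadSets M (k i)) (fun _ X => hookProd X ^ 2)]
    have hle : ∀ i, k i ≤ M := fun i =>
      (hsum ▸ single_le_sum (f := k) (fun _ _ => Nat.zero_le _) (mem_univ i) : k i ≤ n).trans hn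
    rw [prod_congr rfl fun i _ => sum_sq_hookProd (hle i)]
    have hspec := Nat.multinomial_spec univ k
    rw [hsum] at hspec
    rw [← hspec, prod_div_distrib, prod_const_one]
    have h1 : ∏ i, ((k i).factorial : ℚ) ≠ 0 :=
      prod_ne_zero_iff.2 fun i _ => by exact_mod_cast (k i).factorial_ne_zero
    have h2 : (Nat.multinomial univ k : ℚ) ≠ 0 := by exact_mod_cast (Nat.multinomial_pos _ _).ne'
    push_cast
    field_simp
  rw [sum_congr rfl hfib, ← sum_div]
  have := sum_pow_eq_sum_piAntidiag (univ : Finset (Fin s)) (fun _ => (1 : ℚ)) n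
  simp only [sum_const, card_univ, Fintype.card_fin, nsmul_eq_mul, mul_one, one_pow, prod_const_one]
    at this
  rw [this]

end BeadSet

namespace BeadSet

open Finset

/-- The reflected complement of a set of beads in `range L`; it belongs to the conjugate
partition. -/
def conj (L : ℕ) (X : Finset ℕ) : Finset ℕ := (range L).filter fun a => L - 1 - a ∉ X

theorem mem_conj {L : ℕ} {X : Finset ℕ} {a : ℕ} : a ∈ conj L X ↔ a < L ∧ L - 1 - a ∉ X := by
  simp [conj]

theorem card_conj {L : ℕ} {X : Finset ℕ} (hX : X ⊆ range L) : (conj L X).card + X.card = L := by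
  have h : (conj L X).card = (range L \ X).card := by
    refine card_bij' (fun a _ => L - 1 - a) (fun a _ => L - 1 - a) ?_ ?_ ?_ ?_
    · intro a ha
      have := mem_conj.1 ha
      simp only [mem_sdiff, mem_range]
      exact ⟨by omega, this.2⟩
    · intro a ha
      simp only [mem_sdiff, mem_range] at ha
      rw [mem_conj, show L - 1 - (L - 1 - a) = a by omega]
      exact ⟨by omega, ha.2⟩
    · intro a ha
      have := mem_conj.1 ha
      omega
    · intro a ha
      simp only [mem_sdiff, mem_range] at ha
      omega
  rw [h, card_sdiff_add_card_eq_card hX, card_range]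

/-- Conjugation preserves hook lengths. -/
theorem prod_inversions_conj {A : Type*} [CommMonoid A] {L : ℕ} {X : Finset ℕ} (hX : X ⊆ range L)
    (f : ℕ → A) :
    ∏ p ∈ inversions (conj L X), f (p.1 - p.2) = ∏ p ∈ inversions X, f (p.1 - p.2) := by
  refine prod_bij' (fun p _ => ⟨L - 1 - p.2, L - 1 - p.1⟩) (fun p _ => ⟨L - 1 - p.2, L - 1 - p.1⟩)
    ?_ ?_ ?_ ?_ ?_
  · rintro ⟨x, y⟩ h
    simp only [mem_inversions, mem_conj, not_and_or, not_not] at h ⊢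
    obtain ⟨⟨h1, h2⟩, h3, h4⟩ := h
    exact ⟨h4.resolve_left (by omega), by omega, h2⟩
  · rintro ⟨x, y⟩ h
    simp only [mem_inversions, mem_conj, not_and_or, not_not] at h ⊢
    obtain ⟨h1, h3, h4⟩ := h
    have := mem_range.1 (hX h1)
    rw [show L - 1 - (L - 1 - x) = x by omega, show L - 1 - (L - 1 - y) = y by omega]
    exact ⟨⟨by omega, h4⟩, by omega, Or.inr h1⟩
  · rintro ⟨x, y⟩ h
    simp only [mem_inversions, mem_conj] at h
    simp only [Sigma.mk.injEq, heq_eq_eq]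
    omega
  · rintro ⟨x, y⟩ h
    simp only [mem_inversions] at h
    have := mem_range.1 (hX h.1)
    simp only [Sigma.mk.injEq, heq_eq_eq]
    omega
  · rintro ⟨x, y⟩ h
    simp only [mem_inversions, mem_conj] at h
    congr 1
    simp only
    omega

end BeadSet

namespace YoungDiagram

open Finset BeadSet

theorem hookLength_add (μ : YoungDiagram) {i j : ℕ} (h : (i, j) ∈ μ) :
    μ.hookLength (i, j) + (i + j + 1) = μ.rowLen i + μ.colLen j := by
  have h1 := mem_iff_lt_rowLen.1 h
  have h2 := mem_iff_lt_colLen.1 h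
  have hset : μ.hook (i, j) =
      ({i} ×ˢ Ico j (μ.rowLen i)) ∪ (Ico (i + 1) (μ.colLen j) ×ˢ {j}) := by
    ext ⟨a, b⟩
    simp only [hook, mem_filter, mem_cells, mem_union, mem_product, mem_singleton, mem_Ico]
    constructor
    · rintro ⟨hab, ⟨rfl, hb⟩ | ⟨rfl, ha⟩⟩
      · exact Or.inl ⟨rfl, hb, mem_iff_lt_rowLen.1 hab⟩
      · rcases ha.eq_or_lt with rfl | ha
        · exact Or.inl ⟨rfl, le_rfl, h1⟩
        · exact Or.inr ⟨⟨ha, mem_iff_lt_colLen.1 hab⟩, rfl⟩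
    · rintro (⟨rfl, hb, hb'⟩ | ⟨⟨ha, ha'⟩, rfl⟩)
      · exact ⟨mem_iff_lt_rowLen.2 hb', Or.inl ⟨rfl, hb⟩⟩
      · exact ⟨mem_iff_lt_colLen.2 ha', Or.inr ⟨rfl, by omega⟩⟩
  have hdisj : Disjoint ({i} ×ˢ Ico j (μ.rowLen i)) (Ico (i + 1) (μ.colLen j) ×ˢ {j}) := by
    rw [Finset.disjoint_left]
    rintro ⟨a, b⟩ ha hb
    simp only [mem_product, mem_singleton, mem_Ico] at ha hb
    omega
  rw [hookLength, hset, card_union_of_disjoint hdisj, card_product, card_product, card_singleton,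
    card_singleton, Nat.card_Ico, Nat.card_Ico]
  omega

/-- The diagram fits into the square with side `N`. -/
def InSquare (N : ℕ) (μ : YoungDiagram) : Prop := ∀ c ∈ μ, c.1 < N ∧ c.2 < N

theorem inSquare_of_card_le {N : ℕ} {μ : YoungDiagram} (h : μ.card ≤ N) : InSquare N μ := by
  rintro ⟨i, j⟩ hc
  constructor
  · refine (mem_iff_lt_colLen.1 hc).trans_le (le_trans ?_ h)
    rw [colLen_eq_card]
    exact card_le_card (filter_subset _ _)
  · refine (mem_iff_lt_rowLen.1 hc).trans_le (le_trans ?_ h)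
    rw [rowLen_eq_card]
    exact card_le_card (filter_subset _ _)

theorem InSquare.rowLen_le {N : ℕ} {μ : YoungDiagram} (h : InSquare N μ) (i : ℕ) :
    μ.rowLen i ≤ N := by
  by_contra! hN
  exact lt_irrefl _ (h _ (mem_iff_lt_rowLen.2 hN)).2

theorem InSquare.colLen_le {N : ℕ} {μ : YoungDiagram} (h : InSquare N μ) (j : ℕ) :
    μ.colLen j ≤ N := by
  by_contra! hN
  exact lt_irrefl _ (h _ (mem_iff_lt_colLen.2 hN)).1

theorem InSquare.transpose {N : ℕ} {μ : YoungDiagram} (h : InSquare N μ) :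
    InSquare N μ.transpose := fun _ hc => (h _ (mem_transpose.1 hc)).symm

/-- The bead of row `i`: its first column hook length, if the number of rows is taken to be `N`. -/
def bead (N : ℕ) (μ : YoungDiagram) (i : ℕ) : ℕ := μ.rowLen i + (N - 1 - i)

/-- The gap of column `j`. -/
def gap (N : ℕ) (μ : YoungDiagram) (j : ℕ) : ℕ := N - μ.colLen j + j

def beads (N : ℕ) (μ : YoungDiagram) : Finset ℕ := (range N).image (bead N μ)

theorem bead_lt_bead {N : ℕ} (μ : YoungDiagram) {i k : ℕ} (hik : i < k) (hk : k < N) :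
    bead N μ k < bead N μ i := by
  have := μ.rowLen_anti i k hik.le
  simp only [bead]
  omega

theorem gap_lt_gap {N : ℕ} (μ : YoungDiagram) {i k : ℕ} (hik : i < k) :
    gap N μ i < gap N μ k := by
  have := μ.colLen_anti i k hik.le
  simp only [gap]
  omega

theorem gap_lt_bead {N : ℕ} {μ : YoungDiagram} (h : InSquare N μ) {i j : ℕ} (hij : (i, j) ∈ μ) :
    gap N μ j < bead N μ i := by
  have h1 := mem_iff_lt_rowLen.1 hij
  have h2 := mem_iff_lt_colLen.1 hij
  have h3 := h.colLen_le j
  simp only [gap, bead]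
  omega

theorem bead_lt_gap {N : ℕ} {μ : YoungDiagram} {i j : ℕ} (hi : i < N)
    (hij : (i, j) ∉ μ) : bead N μ i < gap N μ j := by
  have h1 := mt mem_iff_lt_rowLen.2 hij
  have h2 := mt mem_iff_lt_colLen.2 hij
  simp only [gap, bead]
  omega

theorem bead_injOn (N : ℕ) (μ : YoungDiagram) : Set.InjOn (bead N μ) (range N : Set ℕ) := by
  intro i hi k hk h
  simp only [coe_range, Set.mem_Iio] at hi hk
  rcases lt_trichotomy i k with hik | hik | hik
  · exact absurd h (bead_lt_bead μ hik hk).ne'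
  · exact hik
  · exact absurd h (bead_lt_bead μ hik hi).ne

theorem gap_injective (N : ℕ) (μ : YoungDiagram) : Function.Injective (gap N μ) :=
  (strictMono_nat_of_lt_succ fun i => gap_lt_gap μ (Nat.lt_succ_self i)).injective

theorem card_beads (N : ℕ) (μ : YoungDiagram) : (beads N μ).card = N := by
  rw [beads, card_image_of_injOn (bead_injOn N μ), card_range]

theorem gap_notMem_beads {N : ℕ} {μ : YoungDiagram} (h : InSquare N μ) (j : ℕ) :
    gap N μ j ∉ beads N μ := by
  intro hj
  obtain ⟨i, hi, hij⟩ := mem_image.1 hj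
  by_cases hm : (i, j) ∈ μ
  · exact (gap_lt_bead h hm).ne' hij
  · exact (bead_lt_gap (mem_range.1 hi) hm).ne hij

theorem beads_subset {N : ℕ} {μ : YoungDiagram} (h : InSquare N μ) :
    beads N μ ⊆ range (2 * N) := by
  intro a ha
  obtain ⟨i, hi, rfl⟩ := mem_image.1 ha
  have := h.rowLen_le i
  rw [mem_range] at hi ⊢
  simp only [bead]
  omega

theorem notMem_beads_iff {N : ℕ} {μ : YoungDiagram} (h : InSquare N μ) {a : ℕ} (ha : a < 2 * N) :
    a ∉ beads N μ ↔ ∃ j < N, gap N μ j = a := by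
  constructor
  · have hsub : (range N).image (gap N μ) ⊆ range (2 * N) \ beads N μ := by
      intro b hb
      obtain ⟨j, hj, rfl⟩ := mem_image.1 hb
      refine mem_sdiff.2 ⟨?_, gap_notMem_beads h j⟩
      rw [mem_range] at hj ⊢
      simp only [gap]
      omega
    have heq := eq_of_subset_of_card_le hsub (by
      have := card_sdiff_add_card_eq_card (beads_subset h)
      rw [card_beads, card_range] at this
      rw [card_image_of_injective _ (gap_injective N μ), card_range]
      omega)
    intro hn
    have : a ∈ (range N).image (gap N μ) := by
      rw [heq]
      exact mem_sdiff.2 ⟨mem_range.2 ha, hn⟩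
    simpa using this
  · rintro ⟨j, -, rfl⟩
    exact gap_notMem_beads h j

theorem inversions_beads {N : ℕ} {μ : YoungDiagram} (h : InSquare N μ) :
    inversions (beads N μ) = μ.cells.image fun c => ⟨bead N μ c.1, gap N μ c.2⟩ := by
  ext ⟨x, y⟩
  simp only [mem_inversions, mem_image, mem_cells, Sigma.mk.injEq, heq_eq_eq, Prod.exists]
  constructor
  · rintro ⟨hx, hlt, hy⟩
    have hx' := mem_range.1 (beads_subset h hx)
    obtain ⟨j, -, rfl⟩ := (notMem_beads_iff h (by omega)).1 hy
    obtain ⟨i, hi, rfl⟩ := mem_image.1 hx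
    refine ⟨i, j, ?_, rfl, rfl⟩
    by_contra hm
    exact hlt.not_gt (bead_lt_gap (mem_range.1 hi) hm)
  · rintro ⟨i, j, hij, rfl, rfl⟩
    exact ⟨mem_image_of_mem _ (mem_range.2 (h _ hij).1), gap_lt_bead h hij, gap_notMem_beads h j⟩

theorem hookLengths_eq {N : ℕ} {μ : YoungDiagram} (h : InSquare N μ) :
    μ.hookLengths = (inversions (beads N μ)).val.map fun p => p.1 - p.2 := by
  rw [inversions_beads h, image_val_of_injOn, Multiset.map_map]
  · refine Multiset.map_congr rfl ?_
    rintro ⟨i, j⟩ hc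
    have hij : (i, j) ∈ μ := (mem_cells _).1 hc
    have h1 := hookLength_add μ hij
    have h2 := gap_lt_bead h hij
    have h3 := h.colLen_le j
    have h4 := (h _ hij).1
    simp only [Function.comp, gap, bead] at h2 h4 ⊢
    omega
  · rintro ⟨i, j⟩ hc ⟨k, l⟩ hd heq
    simp only [Sigma.mk.injEq, heq_eq_eq] at heq
    rw [mem_coe, mem_cells] at hc hd
    exact Prod.ext (bead_injOn N μ (mem_coe.2 (mem_range.2 (h _ hc).1))
      (mem_coe.2 (mem_range.2 (h _ hd).1)) heq.1) (gap_injective N μ heq.2)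

theorem weight_beads {N : ℕ} {μ : YoungDiagram} (h : InSquare N μ) :
    weight (beads N μ) = μ.card := by
  have := congrArg Multiset.card (hookLengths_eq h)
  rw [hookLengths, Multiset.card_map, Multiset.card_map] at this
  exact this.symm

theorem beads_transpose {N : ℕ} {μ : YoungDiagram} (h : InSquare N μ) :
    beads N μ.transpose = conj (2 * N) (beads N μ) := by
  have key : ∀ j < N, bead N μ.transpose j = 2 * N - 1 - gap N μ j ∧ gap N μ j < 2 * N := by
    intro j hj
    have := h.colLen_le j
    simp only [bead, gap, rowLen_transpose]
    omega
  ext a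
  rw [mem_conj]
  constructor
  · intro ha
    obtain ⟨j, hj, rfl⟩ := mem_image.1 ha
    obtain ⟨h1, h2⟩ := key j (mem_range.1 hj)
    refine ⟨by omega, ?_⟩
    rw [h1, show 2 * N - 1 - (2 * N - 1 - gap N μ j) = gap N μ j by omega]
    exact gap_notMem_beads h j
  · rintro ⟨ha, ha'⟩
    obtain ⟨j, hj, hja⟩ := (notMem_beads_iff h (by omega)).1 ha'
    obtain ⟨h1, h2⟩ := key j hj
    exact mem_image.2 ⟨j, mem_range.2 hj, by omega⟩

theorem beads_injective {N : ℕ} {μ ν : YoungDiagram} (hμ : InSquare N μ) (hν : InSquare N ν)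
    (h : beads N μ = beads N ν) : μ = ν := by
  have hmono : ∀ ρ : YoungDiagram, StrictMono fun k : Fin N => bead N ρ (N - 1 - k) :=
    fun ρ a b hab => bead_lt_bead ρ (by have := Fin.lt_def.1 hab; omega) (by omega)
  have hmem : ∀ (ρ : YoungDiagram) (k : Fin N), bead N ρ (N - 1 - k) ∈ beads N ρ :=
    fun ρ k => mem_image_of_mem _ (mem_range.2 (by omega))
  have h1 := orderEmbOfFin_unique (card_beads N μ) (hmem μ) (hmono μ)
  have h2 := orderEmbOfFin_unique (card_beads N μ) (fun k => h ▸ hmem ν k) (hmono ν)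
  have hrow : ∀ i, μ.rowLen i = ν.rowLen i := by
    intro i
    by_cases hi : i < N
    · have := congrFun (h1.trans h2.symm) ⟨N - 1 - i, by omega⟩
      simp only [bead, show N - 1 - (N - 1 - i) = i by omega] at this
      omega
    · have hz : ∀ ρ : YoungDiagram, InSquare N ρ → ρ.rowLen i = 0 := fun ρ hρ => by
        by_contra hne
        exact hi (hρ _ (mem_iff_lt_rowLen.2 (Nat.pos_of_ne_zero hne))).1
      rw [hz μ hμ, hz ν hν]
  apply YoungDiagram.ext
  ext ⟨i, j⟩
  rw [mem_cells, mem_cells, mem_iff_lt_rowLen, mem_iff_lt_rowLen, hrow]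

theorem exists_beads_eq {N : ℕ} {X : Finset ℕ} (hX : X ⊆ range (2 * N)) (hc : X.card = N) :
    ∃ μ : YoungDiagram, InSquare N μ ∧ beads N μ = X := by
  set f : ℕ → ℕ := fun k => if h : k < N then X.orderEmbOfFin hc ⟨k, h⟩ else 0 with hf
  have hfmem : ∀ k < N, f k ∈ X := fun k hk => by
    simp only [hf, dif_pos hk]
    exact orderEmbOfFin_mem X hc _
  have hflt : ∀ k, k + 1 < N → f k < f (k + 1) := fun k hk => by
    simp only [hf, dif_pos hk, dif_pos (show k < N by omega)]
    exact (X.orderEmbOfFin hc).strictMono (Fin.lt_def.2 (Nat.lt_succ_self k))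
  have hfadd : ∀ d a, a + d < N → f a + d ≤ f (a + d) := fun d => by
    induction d with
    | zero => intro a _; rfl
    | succ d ih =>
      intro a h
      have h1 := ih a (by omega)
      have h2 := hflt (a + d) (by omega)
      change f a + (d + 1) ≤ f (a + d + 1)
      omega
  have hfle : ∀ i < N, N - 1 - i ≤ f (N - 1 - i) ∧ f (N - 1 - i) ≤ N + (N - 1 - i) := by
    intro i hi
    have h1 := hfadd (N - 1 - i) 0 (by omega)
    have h2 := hfadd i (N - 1 - i) (by omega)
    have h3 := mem_range.1 (hX (hfmem (N - 1 - i + i) (by omega)))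
    rw [zero_add] at h1
    omega
  let μ : YoungDiagram :=
    { cells := (range N ×ˢ range N).filter fun c => c.2 + (N - 1 - c.1) < f (N - 1 - c.1)
      isLowerSet := by
        rintro ⟨i, j⟩ ⟨k, l⟩ hle h
        obtain ⟨h1, h2⟩ := Prod.mk_le_mk.1 hle
        simp only [coe_filter, mem_product, mem_range, Set.mem_ofPred_eq] at h ⊢
        have := hfadd (i - k) (N - 1 - i) (by omega)
        rw [show N - 1 - i + (i - k) = N - 1 - k by omega] at this
        omega }
  have hmem : ∀ i j, (i, j) ∈ μ ↔ (i < N ∧ j < N) ∧ j + (N - 1 - i) < f (N - 1 - i) := by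
    intro i j
    rw [← mem_cells]
    simp [μ]
  have hbead : ∀ i < N, bead N μ i = f (N - 1 - i) := by
    intro i hi
    have := hfle i hi
    have hr : μ.rowLen i = f (N - 1 - i) - (N - 1 - i) := by
      refine eq_of_forall_lt_iff fun j => ?_
      rw [← mem_iff_lt_rowLen, hmem]
      omega
    rw [bead, hr]
    omega
  refine ⟨μ, fun c hcμ => ((hmem c.1 c.2).1 hcμ).1, ?_⟩
  refine eq_of_subset_of_card_le ?_ (by rw [card_beads, hc])
  intro a ha
  obtain ⟨i, hi, rfl⟩ := mem_image.1 ha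
  rw [mem_range] at hi
  rw [hbead i hi]
  exact hfmem _ (by omega)

/-- The sum over self-conjugate partitions as a sum over symmetric sets of beads. -/
theorem sum_selfConjugateWith {A : Type*} [AddCommMonoid A] (g : Multiset ℕ → A) {N m t k : ℕ}
    (hm : m ≤ N) :
    ∑ μ ∈ selfConjugateWith m t k, g (μ.hookLengthsDvd t) =
      ∑ X ∈ (range (2 * N)).powerset with conj (2 * N) X = X ∧ weight X = m ∧
        ((inversions X).filter fun p => t ∣ p.1 - p.2).card = k,
        g (((inversions X).filter fun p => t ∣ p.1 - p.2).val.map fun p => p.1 - p.2) := by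
  have hmemsc : ∀ μ, μ ∈ selfConjugateWith m t k ↔ μ.IsSelfConjugate ∧ μ.card = m ∧
      Multiset.card (μ.hookLengthsDvd t) = k := fun μ => by
    simp [selfConjugateWith]
  have hdvd : ∀ μ, InSquare N μ → μ.hookLengthsDvd t =
      ((inversions (beads N μ)).filter fun p => t ∣ p.1 - p.2).val.map fun p => p.1 - p.2 := by
    intro μ hμ
    rw [hookLengthsDvd, hookLengths_eq hμ, Multiset.filter_map, filter_val]
    rfl
  refine sum_bij (fun μ _ => beads N μ) ?_ ?_ ?_ ?_
  · intro μ hμ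
    obtain ⟨h1, h2, h3⟩ := (hmemsc μ).1 hμ
    have hsq : InSquare N μ := inSquare_of_card_le (h2.trans_le hm)
    rw [mem_filter, mem_powerset]
    refine ⟨beads_subset hsq, ?_, by rw [weight_beads hsq, h2], ?_⟩
    · rw [← beads_transpose hsq, h1]
    · rw [hdvd μ hsq, Multiset.card_map] at h3
      exact h3
  · intro μ hμ ν hν h
    exact beads_injective (inSquare_of_card_le (((hmemsc μ).1 hμ).2.1.trans_le hm))
      (inSquare_of_card_le (((hmemsc ν).1 hν).2.1.trans_le hm)) h
  · intro X hX
    rw [mem_filter, mem_powerset] at hX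
    obtain ⟨h1, h2, h3, h4⟩ := hX
    have hc := card_conj h1
    rw [h2] at hc
    obtain ⟨μ, hsq, rfl⟩ := exists_beads_eq h1 (by omega)
    refine ⟨μ, (hmemsc μ).2 ⟨?_, ?_, ?_⟩, rfl⟩
    · refine beads_injective hsq.transpose hsq ?_
      rw [beads_transpose hsq, h2]
    · rw [← h3, weight_beads hsq]
    · rw [hdvd μ hsq, Multiset.card_map]
      exact h4
  · intro μ hμ
    rw [hdvd μ (inSquare_of_card_le (((hmemsc μ).1 hμ).2.1.trans_le hm))]

end YoungDiagram

namespace BeadSet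

open Finset

/-- The beads on the `i`-th runner of the `t`-abacus. -/
def runner (t L : ℕ) (X : Finset ℕ) (i : ℕ) : Finset ℕ := (range L).filter fun q => t * q + i ∈ X

theorem runner_subset (t L : ℕ) (X : Finset ℕ) (i : ℕ) : runner t L X i ⊆ range L :=
  filter_subset _ _

theorem mul_add_lt_mul {t L q i : ℕ} (hq : q < L) (hi : i < t) : t * q + i < t * L :=
  calc t * q + i < t * (q + 1) := by rw [mul_add]; omega
    _ ≤ t * L := Nat.mul_le_mul_left t hq

theorem mem_runner {t L i q : ℕ} {X : Finset ℕ} (hX : X ⊆ range (t * L)) :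
    q ∈ runner t L X i ↔ t * q + i ∈ X := by
  rw [runner, mem_filter, and_iff_right_iff_imp, mem_range]
  intro h
  have h1 := mem_range.1 (hX h)
  exact Nat.lt_of_mul_lt_mul_left (a := t) (by omega)

theorem mem_iff_div_mem_runner {t L a : ℕ} {X : Finset ℕ} (hX : X ⊆ range (t * L)) :
    a ∈ X ↔ a / t ∈ runner t L X (a % t) := by
  rw [mem_runner hX, Nat.div_add_mod]

@[to_additive]
theorem prod_eq_prod_runner {A : Type*} [CommMonoid A] {t L : ℕ} {X : Finset ℕ}
    (hX : X ⊆ range (t * L)) (ht : 0 < t) (f : ℕ → A) :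
    ∏ x ∈ X, f x = ∏ i ∈ range t, ∏ q ∈ runner t L X i, f (t * q + i) := by
  rw [prod_sigma']
  refine prod_bij' (fun a _ => (⟨a % t, a / t⟩ : Σ _ : ℕ, ℕ)) (fun p _ => t * p.2 + p.1)
    ?_ ?_ ?_ ?_ ?_
  · intro a ha
    rw [mem_sigma, mem_range]
    exact ⟨Nat.mod_lt _ ht, (mem_iff_div_mem_runner hX).1 ha⟩
  · rintro ⟨i, q⟩ h
    rw [mem_sigma, mem_range] at h
    exact (mem_runner hX).1 h.2
  · intro a _
    exact Nat.div_add_mod a t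
  · rintro ⟨i, q⟩ h
    rw [mem_sigma, mem_range] at h
    have h1 : i < t := h.1
    rw [Sigma.mk.injEq, heq_eq_eq]
    constructor
    · change (t * q + i) % t = i
      rw [Nat.mul_add_mod, Nat.mod_eq_of_lt h1]
    · change (t * q + i) / t = q
      rw [Nat.mul_add_div ht, Nat.div_eq_of_lt h1, add_zero]
  · intro a _
    simp only
    rw [Nat.div_add_mod]

/-- The hook lengths divisible by `t` are `t` times the hook lengths on the runners. -/
@[to_additive]
theorem prod_inversions_dvd {A : Type*} [CommMonoid A] {t L : ℕ} {X : Finset ℕ}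
    (hX : X ⊆ range (t * L)) (ht : 0 < t) (f : ℕ → A) :
    ∏ p ∈ inversions X with t ∣ p.1 - p.2, f (p.1 - p.2) =
      ∏ i ∈ range t, ∏ p ∈ inversions (runner t L X i), f (t * (p.1 - p.2)) := by
  have hmod : ∀ {x y : ℕ}, y < x → t ∣ x - y → x % t = y % t := fun {x y} h hd =>
    ((Nat.modEq_iff_dvd' h.le).2 hd).symm
  rw [prod_sigma']
  refine prod_bij' (fun p _ => (⟨p.1 % t, ⟨p.1 / t, p.2 / t⟩⟩ : Σ _ : ℕ, Σ _ : ℕ, ℕ))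
    (fun p _ => ⟨t * p.2.1 + p.1, t * p.2.2 + p.1⟩) ?_ ?_ ?_ ?_ ?_
  · rintro ⟨x, y⟩ h
    simp only [mem_filter, mem_sigma, mem_range, mem_inversions, mem_runner hX] at h ⊢
    obtain ⟨⟨h1, h2, h3⟩, h4⟩ := h
    have h5 := hmod h2 h4
    have h6 := Nat.div_add_mod x t
    have h7 := Nat.div_add_mod y t
    refine ⟨Nat.mod_lt _ ht, by rwa [h6], ?_, by rwa [h5, h7]⟩
    exact Nat.lt_of_mul_lt_mul_left (a := t) (by omega)
  · rintro ⟨i, x, y⟩ h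
    simp only [mem_filter, mem_sigma, mem_range, mem_inversions, mem_runner hX] at h ⊢
    obtain ⟨h1, h2, h3, h4⟩ := h
    have := Nat.mul_lt_mul_of_pos_left h3 ht
    refine ⟨⟨h2, by omega, h4⟩, ?_⟩
    rw [Nat.add_sub_add_right, ← Nat.mul_sub]
    exact dvd_mul_right _ _
  · rintro ⟨x, y⟩ h
    simp only [mem_filter, mem_inversions] at h
    have h5 : t * (y / t) + x % t = y := by rw [hmod h.1.2.1 h.2, Nat.div_add_mod]
    simp only [Nat.div_add_mod, h5]
  · rintro ⟨i, x, y⟩ h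
    rw [mem_sigma, mem_range] at h
    have h1 : i < t := h.1
    simp only [Nat.mul_add_mod, Nat.mod_eq_of_lt h1, Nat.mul_add_div ht, Nat.div_eq_of_lt h1,
      add_zero]
  · rintro ⟨x, y⟩ h
    simp only [mem_filter, mem_inversions] at h
    have h5 := hmod h.1.2.1 h.2
    have h6 := Nat.div_add_mod x t
    have h7 := Nat.div_add_mod y t
    simp only [Nat.mul_sub]
    congr 1
    omega

theorem card_inversions_dvd {t L : ℕ} {X : Finset ℕ} (hX : X ⊆ range (t * L)) (ht : 0 < t) :
    ((inversions X).filter fun p => t ∣ p.1 - p.2).card =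
      ∑ i ∈ range t, weight (runner t L X i) := by
  simp_rw [weight, card_eq_sum_ones]
  exact sum_inversions_dvd hX ht fun _ => 1

theorem weight_conj {L : ℕ} {X : Finset ℕ} (hX : X ⊆ range L) : weight (conj L X) = weight X := by
  simp_rw [weight, card_eq_sum_ones]
  exact prod_inversions_conj (A := Multiplicative ℕ) hX fun _ => Multiplicative.ofAdd 1

/-- The weight in terms of the weights of the runners (the `t`-quotient) and the deviations of
their numbers of beads from the mean (the `t`-core). -/
theorem two_mul_weight_eq {t L M : ℕ} {X : Finset ℕ} (hX : X ⊆ range (t * L)) (ht : 0 < t)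
    (hc : X.card = t * M) :
    (2 * weight X : ℤ) = 2 * t * ∑ i ∈ range t, (weight (runner t L X i) : ℤ) +
      ∑ i ∈ range t, (t * ((runner t L X i).card - M : ℤ) ^ 2 +
        (2 * i - (t - 1)) * ((runner t L X i).card - M : ℤ)) := by
  have hchoose : ∀ Y : Finset ℕ,
      (2 * weight Y : ℤ) = 2 * ∑ x ∈ Y, (x : ℤ) - Y.card * (Y.card - 1) := by
    intro Y
    have h1 : (weight Y : ℤ) + (Y.card.choose 2 : ℕ) = ∑ x ∈ Y, (x : ℤ) := by
      rw [← Nat.cast_add, weight_add_choose, Nat.cast_sum]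
    have h2 : (2 * (Y.card.choose 2 : ℕ) : ℤ) = Y.card * (Y.card - 1) := by
      rw [Nat.choose_two_right]
      have h3 := Nat.div_mul_cancel (Nat.even_mul_pred_self Y.card).two_dvd
      have h4 : ((Y.card * (Y.card - 1) : ℕ) : ℤ) = Y.card * (Y.card - 1) := by
        rcases Nat.eq_zero_or_pos Y.card with h | h
        · simp [h]
        · rw [Nat.cast_mul, Nat.cast_sub h]
          simp
      rw [← h4]
      exact_mod_cast (mul_comm _ _).trans h3
    linarith
  have hsum : ∑ x ∈ X, (x : ℤ) = ∑ i ∈ range t,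
      (t * ∑ q ∈ runner t L X i, (q : ℤ) + i * (runner t L X i).card) := by
    rw [sum_eq_sum_runner hX ht]
    refine sum_congr rfl fun i _ => ?_
    push_cast
    rw [sum_add_distrib, mul_sum, sum_const, nsmul_eq_mul, mul_comm (i : ℤ)]
  have hcard : ∑ i ∈ range t, ((runner t L X i).card - M : ℤ) = 0 := by
    rw [sum_sub_distrib, sum_const, card_range, nsmul_eq_mul, sub_eq_zero]
    have := sum_eq_sum_runner hX ht (fun _ => (1 : ℤ))
    simp only [sum_const, nsmul_eq_mul, mul_one] at this
    rw [← this, hc]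
    push_cast
    rfl
  have hgauss : ∑ i ∈ range t, (2 * i : ℤ) = t * (t - 1) := by
    clear hX hc hsum hcard
    induction t with
    | zero => simp
    | succ t ih =>
      rcases Nat.eq_zero_or_pos t with rfl | h
      · simp
      · rw [sum_range_succ, ih h]
        push_cast
        ring
  have hterm : ∀ i ∈ range t, (2 * (t * ∑ q ∈ runner t L X i, (q : ℤ) +
      i * (runner t L X i).card) : ℤ) = 2 * t * weight (runner t L X i) +
      (t * ((runner t L X i).card - M : ℤ) ^ 2 +
        (2 * i - (t - 1)) * ((runner t L X i).card - M : ℤ)) +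
      ((2 * t * M - 1) * ((runner t L X i).card - M : ℤ) + (t * M * (M - 1) + 2 * i * M)) := by
    intro i _
    have := hchoose (runner t L X i)
    linear_combination (-t : ℤ) * this
  have hconst : ∑ i ∈ range t, (t * M * (M - 1) + 2 * i * M : ℤ) =
      t * (t * M * (M - 1)) + t * (t - 1) * M := by
    rw [sum_add_distrib, sum_const, card_range, nsmul_eq_mul, ← sum_mul, hgauss]
  rw [hchoose X, hsum, mul_sum, sum_congr rfl hterm, sum_add_distrib, sum_add_distrib,
    sum_add_distrib (f := fun i => (2 * t * M - 1 : ℤ) * _), ← mul_sum, ← mul_sum, hcard,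
    hconst, hc]
  push_cast
  ring

theorem card_runner_eq_of_weight_eq {t L M : ℕ} {X : Finset ℕ} (hX : X ⊆ range (t * L)) (ht : 0 < t)
    (hc : X.card = t * M) (hw : weight X = t * ∑ i ∈ range t, weight (runner t L X i)) :
    ∀ i ∈ range t, (runner t L X i).card = M := by
  have h := two_mul_weight_eq hX ht hc
  rw [hw] at h
  push_cast at h
  have hle : ∀ i ∈ range t, |((runner t L X i).card - M : ℤ)| ≤
      t * ((runner t L X i).card - M : ℤ) ^ 2 +
        (2 * i - (t - 1)) * ((runner t L X i).card - M : ℤ) := by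
    intro i hi
    generalize ((runner t L X i).card - M : ℤ) = d
    have hi' : (i : ℤ) + 1 ≤ t := by exact_mod_cast mem_range.1 hi
    have hi0 : (0 : ℤ) ≤ i := by positivity
    have h1 : |d| ≤ d ^ 2 := by
      rw [← sq_abs]
      rcases (abs_nonneg d).eq_or_lt with h | h
      · rw [← h]; simp
      · nlinarith
    have h2 : -((t - 1 : ℤ) * |d|) ≤ (2 * i - (t - 1)) * d := by
      refine le_trans (neg_le_neg ?_) (neg_abs_le _)
      rw [abs_mul]
      refine mul_le_mul_of_nonneg_right ?_ (abs_nonneg d)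
      rw [abs_le]
      constructor <;> linarith
    have h3 : (t : ℤ) * |d| ≤ t * d ^ 2 := mul_le_mul_of_nonneg_left h1 (by positivity)
    linarith
  have hzero : ∑ i ∈ range t, |((runner t L X i).card - M : ℤ)| = 0 := by
    refine le_antisymm ((sum_le_sum hle).trans ?_) (sum_nonneg fun _ _ => abs_nonneg _)
    linarith
  intro i hi
  have := (sum_eq_zero_iff_of_nonneg fun _ _ => abs_nonneg _).1 hzero i hi
  rw [abs_eq_zero, sub_eq_zero] at this
  exact_mod_cast this

theorem weight_eq_of_card_runner_eq {t L M : ℕ} {X : Finset ℕ} (hX : X ⊆ range (t * L)) (ht : 0 < t)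
    (hc : X.card = t * M) (h : ∀ i ∈ range t, (runner t L X i).card = M) :
    weight X = t * ∑ i ∈ range t, weight (runner t L X i) := by
  have h1 := two_mul_weight_eq hX ht hc
  have h0 : ∑ i ∈ range t, (t * ((runner t L X i).card - M : ℤ) ^ 2 +
      (2 * i - (t - 1)) * ((runner t L X i).card - M : ℤ)) = 0 :=
    sum_eq_zero fun i hi => by rw [h i hi]; ring
  rw [h0] at h1
  have h2 : (weight X : ℤ) = t * ∑ i ∈ range t, (weight (runner t L X i) : ℤ) := by linarith
  exact_mod_cast h2

theorem reflect_mul_add {t L q i : ℕ} (hq : q < L) (hi : i < t) :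
    t * L - 1 - (t * q + i) = t * (L - 1 - q) + (t - 1 - i) := by
  obtain ⟨k, rfl⟩ : ∃ k, L = q + 1 + k := ⟨L - 1 - q, by omega⟩
  rw [show q + 1 + k - 1 - q = k by omega, mul_add, mul_add]
  omega

theorem runner_reflect {t L i : ℕ} {X : Finset ℕ} (hi : i < t) (hsym : conj (t * L) X = X) :
    runner t L X (t - 1 - i) = conj L (runner t L X i) := by
  ext q
  rw [runner, mem_filter, mem_range, mem_conj]
  refine and_congr_right fun hq => ?_
  have hr := reflect_mul_add hq (show t - 1 - i < t by omega)
  rw [show t - 1 - (t - 1 - i) = i by omega] at hr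
  nth_rw 1 [← hsym]
  rw [mem_conj, hr, runner, mem_filter, mem_range, not_and_or]
  refine ⟨fun h => Or.inr h.2, fun h => ⟨mul_add_lt_mul hq (by omega), h.resolve_left (by omega)⟩⟩

/-- The symmetric set of beads with prescribed runners `G i` for `i < s`. -/
def glue (s L : ℕ) (G : ℕ → Finset ℕ) : Finset ℕ :=
  (range (2 * s * L)).filter fun a => if a % (2 * s) < s then a / (2 * s) ∈ G (a % (2 * s)) else
    L - 1 - a / (2 * s) ∉ G (2 * s - 1 - a % (2 * s))

theorem mem_glue {s L q i : ℕ} {G : ℕ → Finset ℕ} (hq : q < L) (hi : i < 2 * s) :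
    2 * s * q + i ∈ glue s L G ↔
      if i < s then q ∈ G i else L - 1 - q ∉ G (2 * s - 1 - i) := by
  rw [glue, mem_filter, mem_range, Nat.mul_add_mod, Nat.mod_eq_of_lt hi,
    Nat.mul_add_div (by omega), Nat.div_eq_of_lt hi, add_zero]
  exact and_iff_right (mul_add_lt_mul hq hi)

theorem runner_glue {s L i : ℕ} {G : ℕ → Finset ℕ} (hi : i < s) (hG : G i ⊆ range L) :
    runner (2 * s) L (glue s L G) i = G i := by
  ext q
  rw [runner, mem_filter, mem_range]
  constructor
  · rintro ⟨hq, h⟩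
    rwa [mem_glue hq (by omega), if_pos hi] at h
  · intro h
    have hq := mem_range.1 (hG h)
    exact ⟨hq, by rwa [mem_glue hq (by omega), if_pos hi]⟩

theorem conj_glue {s L : ℕ} (hs : 0 < s) (G : ℕ → Finset ℕ) :
    conj (2 * s * L) (glue s L G) = glue s L G := by
  ext a
  rw [mem_conj]
  by_cases ha : a < 2 * s * L
  swap
  · exact iff_of_false (fun h => ha h.1) fun h => ha (mem_range.1 (filter_subset _ _ h))
  rw [and_iff_right ha]
  have h2s : 0 < 2 * s := by omega
  have hi : a % (2 * s) < 2 * s := Nat.mod_lt _ h2s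
  have hq : a / (2 * s) < L := Nat.div_lt_of_lt_mul ha
  rw [← Nat.div_add_mod a (2 * s)]
  generalize a % (2 * s) = i at hi
  generalize a / (2 * s) = q at hq
  rw [reflect_mul_add hq hi, mem_glue (by omega) (by omega), mem_glue hq hi,
    show L - 1 - (L - 1 - q) = q by omega, show 2 * s - 1 - (2 * s - 1 - i) = i by omega]
  by_cases h : i < s
  · rw [if_pos h, if_neg (by omega), not_not]
  · rw [if_neg h, if_pos (by omega)]

theorem eq_of_runner_eq {s L : ℕ} (hs : 0 < s) {X Y : Finset ℕ} (hX : X ⊆ range (2 * s * L))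
    (hY : Y ⊆ range (2 * s * L)) (hXs : conj (2 * s * L) X = X) (hYs : conj (2 * s * L) Y = Y)
    (h : ∀ i < s, runner (2 * s) L X i = runner (2 * s) L Y i) : X = Y := by
  have h2s : 0 < 2 * s := by omega
  have hall : ∀ i < 2 * s, runner (2 * s) L X i = runner (2 * s) L Y i := by
    intro i hi
    by_cases his : i < s
    · exact h i his
    · have hr : ∀ Z, conj (2 * s * L) Z = Z →
          runner (2 * s) L Z i = conj L (runner (2 * s) L Z (2 * s - 1 - i)) := fun Z hZ => by
        rw [← runner_reflect (by omega) hZ, show 2 * s - 1 - (2 * s - 1 - i) = i by omega]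
      rw [hr X hXs, hr Y hYs, h _ (by omega)]
  ext a
  rw [mem_iff_div_mem_runner hX, mem_iff_div_mem_runner hY, hall _ (Nat.mod_lt _ h2s)]

theorem prod_range_two_mul_eq {A : Type*} [CommMonoid A] (s : ℕ) (f : ℕ → A) :
    ∏ i ∈ range (2 * s), f i = ∏ i ∈ range s, f i * f (2 * s - 1 - i) := by
  rw [two_mul, prod_range_add, prod_mul_distrib, ← prod_range_reflect (fun x => f (s + x))]
  congr 1
  refine prod_congr rfl fun i hi => ?_
  have := mem_range.1 hi
  congr 1
  omega

theorem sum_range_two_mul_eq {A : Type*} [AddCommMonoid A] (s : ℕ) (f : ℕ → A) :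
    ∑ i ∈ range (2 * s), f i = ∑ i ∈ range s, (f i + f (2 * s - 1 - i)) :=
  prod_range_two_mul_eq (A := Multiplicative A) s f

theorem prod_inversions_mul (t : ℕ) (X : Finset ℕ) :
    ∏ p ∈ inversions X, 1 / ((t * (p.1 - p.2) : ℕ) : ℚ) = (1 / (t : ℚ)) ^ weight X * hookProd X := by
  rw [weight, ← prod_const, hookProd, ← prod_mul_distrib]
  refine prod_congr rfl fun p hp => ?_
  rw [Nat.cast_mul, Nat.cast_sub (mem_inversions.1 hp).2.1.le, one_div, one_div, mul_inv]

theorem prod_inversions_dvd_of_symm {s L : ℕ} (hs : 0 < s) {X : Finset ℕ}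
    (hX : X ⊆ range (2 * s * L)) (hXs : conj (2 * s * L) X = X) :
    ∏ p ∈ inversions X with 2 * s ∣ p.1 - p.2, 1 / ((p.1 - p.2 : ℕ) : ℚ) =
      (1 / ((2 * s : ℕ) : ℚ)) ^ (2 * ∑ i : Fin s, weight (runner (2 * s) L X i)) *
        ∏ i : Fin s, hookProd (runner (2 * s) L X i) ^ 2 := by
  rw [prod_inversions_dvd hX (by omega) fun h => 1 / (h : ℚ), prod_range_two_mul_eq, mul_sum,
    ← prod_pow_eq_pow_sum, ← prod_mul_distrib,
    ← Fin.prod_univ_eq_prod_range (fun i => _ * _) s]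
  refine prod_congr rfl fun i _ => ?_
  rw [runner_reflect (by omega) hXs,
    prod_inversions_conj (runner_subset _ _ _ _) fun h => 1 / ((2 * s * h : ℕ) : ℚ),
    prod_inversions_mul]
  ring

theorem sum_weight_runner_of_symm {s L : ℕ} {X : Finset ℕ}
    (hXs : conj (2 * s * L) X = X) :
    ∑ i ∈ range (2 * s), weight (runner (2 * s) L X i) =
      2 * ∑ i : Fin s, weight (runner (2 * s) L X i) := by
  rw [sum_range_two_mul_eq, mul_sum, ← Fin.sum_univ_eq_sum_range (fun i => _ + _) s]
  refine sum_congr rfl fun i _ => ?_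
  rw [runner_reflect (by omega) hXs, weight_conj (runner_subset _ _ _ _)]
  ring

/-- The conditions on the size and on the number of hook lengths divisible by `2 * s`, in terms of
the runners. -/
theorem weight_and_card_iff {s M n : ℕ} (hs : 0 < s) {X : Finset ℕ}
    (hX : X ⊆ range (2 * s * (2 * M))) (hXs : conj (2 * s * (2 * M)) X = X) :
    (weight X = 2 * (2 * s) * n ∧
      ((inversions X).filter fun p => 2 * s ∣ p.1 - p.2).card = 2 * n) ↔
    (∀ i : Fin s, (runner (2 * s) (2 * M) X i).card = M) ∧
      ∑ i : Fin s, weight (runner (2 * s) (2 * M) X i) = n := by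
  have h2s : 0 < 2 * s := by omega
  have hc : X.card = 2 * s * M := by
    have := card_conj hX
    rw [hXs, show 2 * s * (2 * M) = 2 * (2 * s * M) by ring] at this
    omega
  have hsum := sum_weight_runner_of_symm hXs
  rw [card_inversions_dvd hX h2s]
  constructor
  · rintro ⟨h1, h2⟩
    refine ⟨fun i => card_runner_eq_of_weight_eq hX h2s hc ?_ i (mem_range.2 (by omega)), by omega⟩
    rw [h1, h2]
    ring
  · rintro ⟨h1, h2⟩
    rw [h2] at hsum
    refine ⟨?_, hsum⟩
    rw [weight_eq_of_card_runner_eq hX h2s hc, hsum]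
    · ring
    · intro i hi
      rw [mem_range] at hi
      by_cases his : i < s
      · exact h1 ⟨i, his⟩
      · have h3 := runner_reflect (i := 2 * s - 1 - i) (by omega) hXs
        rw [show 2 * s - 1 - (2 * s - 1 - i) = i by omega] at h3
        have h4 := card_conj (runner_subset (2 * s) (2 * M) X (2 * s - 1 - i))
        rw [← h3, h1 ⟨2 * s - 1 - i, by omega⟩] at h4
        omega

theorem sum_symm_eq {s M n : ℕ} (hs : 0 < s) (hn : n ≤ M) :
    ∑ X ∈ (range (2 * s * (2 * M))).powerset with conj (2 * s * (2 * M)) X = X ∧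
        weight X = 2 * (2 * s) * n ∧
        ((inversions X).filter fun p => 2 * s ∣ p.1 - p.2).card = 2 * n,
      ∏ p ∈ inversions X with 2 * s ∣ p.1 - p.2, 1 / ((p.1 - p.2 : ℕ) : ℚ) =
    (1 / ((2 * s : ℕ) : ℚ)) ^ (2 * n) * ((s : ℚ) ^ n / n.factorial) := by
  rw [← sum_piFinset_hookProd s hn, mul_sum]
  refine sum_bij (fun X _ (i : Fin s) => runner (2 * s) (2 * M) X i) ?_ ?_ ?_ ?_
  · intro X hX
    rw [mem_filter, mem_powerset] at hX
    obtain ⟨h1, h2, h3⟩ := hX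
    rw [weight_and_card_iff hs h1 h2] at h3
    rw [mem_filter, Fintype.mem_piFinset]
    exact ⟨fun i => mem_powersetCard.2 ⟨runner_subset _ _ _ _, h3.1 i⟩, h3.2⟩
  · intro X hX Y hY h
    rw [mem_filter, mem_powerset] at hX hY
    exact eq_of_runner_eq hs hX.1 hY.1 hX.2.1 hY.2.1 fun i hi => congrFun h ⟨i, hi⟩
  · intro F hF
    rw [mem_filter, Fintype.mem_piFinset] at hF
    obtain ⟨h1, h2⟩ := hF
    have hF' : ∀ i : Fin s, runner (2 * s) (2 * M)
        (glue s (2 * M) fun i => if h : i < s then F ⟨i, h⟩ else ∅) i = F i := by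
      intro i
      rw [runner_glue i.2]
      · simp
      · simpa using (mem_powersetCard.1 (h1 i)).1
    refine ⟨glue s (2 * M) fun i => if h : i < s then F ⟨i, h⟩ else ∅, ?_, funext hF'⟩
    have hsub : (glue s (2 * M) fun i => if h : i < s then F ⟨i, h⟩ else ∅) ⊆
        range (2 * s * (2 * M)) := filter_subset _ _
    rw [mem_filter, mem_powerset]
    refine ⟨hsub, conj_glue hs _, (weight_and_card_iff hs hsub (conj_glue hs _)).2 ?_⟩
    simp_rw [hF']
    exact ⟨fun i => (mem_powersetCard.1 (h1 i)).2, h2⟩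
  · intro X hX
    rw [mem_filter, mem_powerset] at hX
    obtain ⟨h1, h2, h3⟩ := hX
    rw [prod_inversions_dvd_of_symm hs h1 h2, ((weight_and_card_iff hs h1 h2).1 h3).2]

end BeadSet

theorem theorem1p4 (n t : ℕ) (hn : 0 < n) (ht : 0 < t) (hte : Even t) :
    ∑ μ ∈ YoungDiagram.selfConjugateWith (2 * t * n) t (2 * n),
      ((μ.hookLengthsDvd t).map fun h : ℕ => 1 / (h : ℚ)).prod =
    1 / ((n.factorial : ℚ) * 2 ^ n * (t : ℚ) ^ n) := by
  obtain ⟨s, rfl⟩ := hte.two_dvd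
  have hs : 0 < s := by omega
  rw [YoungDiagram.sum_selfConjugateWith (N := 2 * s * (2 * n))
    (fun H => (H.map fun h : ℕ => 1 / (h : ℚ)).prod) (le_of_eq (by ring))]
  simp_rw [Multiset.map_map]
  have h := BeadSet.sum_symm_eq (M := 2 * n) (n := n) hs (by omega)
  rw [show 2 * s * (2 * (2 * n)) = 2 * (2 * s * (2 * n)) by ring] at h
  refine Eq.trans h ?_
  have hs' : (s : ℚ) ≠ 0 := by exact_mod_cast hs.ne'
  have hf : (n.factorial : ℚ) ≠ 0 := by exact_mod_cast n.factorial_ne_zero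
  push_cast
  rw [pow_mul, div_pow, div_pow, mul_pow, mul_pow, one_pow, one_pow]
  have h4 : (4 : ℚ) ^ n = 2 ^ n * 2 ^ n := by rw [← mul_pow]; norm_num
  field_simp
  norm_num
  rw [h4]
  ring
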